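/- Let $\mathcal X\subseteq\mathbb R^n$ be path-connected with $0\in\mathcal X$, let $\mathcal U\subseteq\mathbb R^m$ be non-empty, let $\mathcal D\subseteq\mathbb R^l$ contain $0$, and let $f:\mathcal X\times\mathcal U\times\mathcal D\to\mathbb R^n$ be locally Lipschitz. Class $\mathcal K_\infty$ is the set of continuous, strictly increasing, unbounded $\alpha:[0,\infty)\to[0,\infty)$ with $\alpha(0)=0$; class $\mathcal{KL}_\infty$ is the set of continuous $\beta:[0,\infty)^2\to[0,\infty)$ such that $\beta(\cdot,s)\in\mathcal K_\infty$ for every $s$ and $\beta(r,\cdot)$ is non-increasing with limit $0$ at $\infty$ for every $r$. A function on a subset of a Euclidean space is called continuously differentiable if it is given with a $C^1$ extension to an open neighbourhood of that subset, and its derivatives are those of the extension. Let $\Pi:\mathcal X\to\mathbb R^k$ be a dynamic projection, that is, $\Pi$ is continuously differentiable and there are $\underline\sigma,\overline\sigma\in\mathcal K_\infty$ with $\underline\sigma(\|x\|)\le\|\Pi(x)\|\le\overline\sigma(\|x\|)$ for all $x\in\mathcal X$. Put $$\delta(x,u,d)=D_\Pi(x)\bigl(f(x,u,d)-f(x,u,0)\bigr),\qquad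 \Delta(x)=\{\delta(x,u,d):u\in\mathcal U,\ d\in\mathcal D\},$$ so that the projected dynamics are $\dot y=D_\Pi(x)f(x,u,0)+\delta$. Suppose that these dynamics have a PSS-CLF $W$: a continuously differentiable function $W$ on $\Pi(\mathcal X)$ for which there are $\underline\alpha,\overline\alpha,\alpha,\rho\in\mathcal K_\infty$ such that, for all $x\in\mathcal X$, $\underline\alpha(\|\Pi(x)\|)\le W(\Pi(x))\le\overline\alpha(\|\Pi(x)\|)$ and, for all $\delta\in\Delta(x)$, $$\|\Pi(x)\|\ge\rho(\|\delta\|)\ \Longrightarrow\ \inf_{u\in\mathcal U}\dot W(x,u,\delta)\le-\alpha(\|\Pi(x)\|),\qquad \dot W(x,u,\delta)=DW(\Pi(x))\bigl(D_\Pi(x)f(x,u,0)+\delta\bigr).$$ Then the disturbed system $\dot x=f(x,u,d)$ is Projection to State Stable with respect to $\Pi$ under a suitable state feedback: there is $\kappa:\mathcal X\to\mathcal U$ with the following properties. (a) For some $\alpha',\rho'\in\mathcal K_\infty$, for all $x\in\mathcal X\setminus\{0\}$ and $d\in\mathcal D$, if $\|\Pi(x)\|\ge\rho'(\|\delta(x,\kappa(x),d)\|)$,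 then $\dot W(x,\kappa(x),\delta(x,\kappa(x),d))\le-\alpha'(\|\Pi(x)\|)$. (b) There are $\beta'\in\mathcal{KL}_\infty$ and $\gamma'\in\mathcal K_\infty$ such that, for every $T\in(0,\infty]$, every disturbance signal $d:[0,T)\to\mathcal D$ and every Carathéodory solution $x:[0,T)\to\mathcal X$ of $\dot x=f(x,\kappa(x),d(t))$ along which $\delta(t)=\delta(x(t),\kappa(x(t)),d(t))$ is essentially bounded, $$\|x(t)\|\le\beta'(\|x(0)\|,t)+\gamma'\Bigl(\operatorname*{ess\,sup}_{\tau\in[0,T)}\|\delta(\tau)\|\Bigr)\qquad\text{for all }t\in[0,T).$$ Moreover, every feedback $\kappa:\mathcal X\to\mathcal U$ that satisfies (a) satisfies (b). -/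

import Mathlib

open Set Filter Topology MeasureTheory
open scoped NNReal ENNReal

noncomputable section

namespace ProjStab

/-- Euclidean space of dimension `n`. -/
abbrev Eucl (n : ℕ) := EuclideanSpace ℝ (Fin n)

/-- Class `K`, for functions defined on all of `[0, ∞)`. -/
structure IsClassK (α : ℝ≥0 → ℝ≥0) : Prop where
  continuous : Continuous α
  strictMono : StrictMono α
  map_zero : α 0 = 0

/-- Class `K∞`. -/
structure IsClassKInfty (α : ℝ≥0 → ℝ≥0) : Prop extends IsClassK α where
  unbounded : Tendsto α atTop atTop

/-- Class `KL∞`: jointly continuous, class `K∞` in the first argument, and non-increasing with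
limit `0` in the second argument. -/
structure IsClassKLInfty (β : ℝ≥0 → ℝ≥0 → ℝ≥0) : Prop where
  continuous : Continuous fun p : ℝ≥0 × ℝ≥0 => β p.1 p.2
  classKInfty : ∀ s, IsClassKInfty fun r => β r s
  antitone : ∀ r, Antitone (β r)
  tendsto_zero : ∀ r, Tendsto (β r) atTop (𝓝 0)

/-- `g` is continuously differentiable on the (not necessarily open) set `S`, that is, on some
open set that contains `S`; derivatives at points of `S` are then ordinary derivatives. -/
def IsC1On {E F : Type*} [NormedAddCommGroup E] [NormedSpace ℝ E] [NormedAddCommGroup F]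
    [NormedSpace ℝ F] (g : E → F) (S : Set E) : Prop :=
  ∃ O : Set E, IsOpen O ∧ S ⊆ O ∧ ContDiffOn ℝ 1 g O

/-- A control system with disturbance: states in `X`, controls in `U`, disturbances in `D`,
and dynamics `f`, which matter only on `X × U × D`. -/
structure DisturbedSystem (n m l : ℕ) where
  X : Set (Eucl n)
  U : Set (Eucl m)
  D : Set (Eucl l)
  f : Eucl n → Eucl m → Eucl l → Eucl n
  pathConnected : IsPathConnected X
  zero_mem_X : 0 ∈ X
  nonempty_U : U.Nonempty
  zero_mem_D : 0 ∈ D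
  locallyLipschitz :
    LocallyLipschitzOn (X ×ˢ U ×ˢ D) fun p : Eucl n × Eucl m × Eucl l => f p.1 p.2.1 p.2.2

variable {n m l k : ℕ}

/-- `P` is a dynamic projection on `X`. -/
def IsDynamicProjection (X : Set (Eucl n)) (P : Eucl n → Eucl k) : Prop :=
  IsC1On P X ∧ ∃ σlo σhi : ℝ≥0 → ℝ≥0, IsClassKInfty σlo ∧ IsClassKInfty σhi ∧
    ∀ x ∈ X, σlo ‖x‖₊ ≤ ‖P x‖₊ ∧ ‖P x‖₊ ≤ σhi ‖x‖₊

namespace DisturbedSystem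

variable (S : DisturbedSystem n m l)

/-- The projected disturbance `δ = D_P(x) (f(x, u, d) - f(x, u, 0))`. -/
def delta (P : Eucl n → Eucl k) (x : Eucl n) (u : Eucl m) (d : Eucl l) : Eucl k :=
  fderiv ℝ P x (S.f x u d - S.f x u 0)

/-- The right-hand side `D_P(x) f(x, u, 0) + δ` of the projected dynamics. -/
def projField (P : Eucl n → Eucl k) (x : Eucl n) (u : Eucl m) (δ : Eucl k) : Eucl k :=
  fderiv ℝ P x (S.f x u 0) + δ

/-- The values that the projected disturbance can take at the state `x`. -/
def deltaRange (P : Eucl n → Eucl k) (x : Eucl n) : Set (Eucl k) :=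
  {δ | ∃ u ∈ S.U, ∃ d ∈ S.D, δ = S.delta P x u d}

/-- The derivative of `W` along the projected dynamics, with `δ` as an independent variable. -/
def Wdot (P : Eucl n → Eucl k) (W : Eucl k → ℝ) (x : Eucl n) (u : Eucl m) (δ : Eucl k) : ℝ :=
  fderiv ℝ W (P x) (S.projField P x u δ)

/-- `W` is a Projection to State Stable Control Lyapunov Function for the projected dynamics.
The infimum is taken in the extended reals, so it may be `-∞`. -/
def IsPSSCLF (P : Eucl n → Eucl k) (W : Eucl k → ℝ) : Prop :=
  IsC1On W (P '' S.X) ∧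
  ∃ αlo αhi α ρ : ℝ≥0 → ℝ≥0,
    IsClassKInfty αlo ∧ IsClassKInfty αhi ∧ IsClassKInfty α ∧ IsClassKInfty ρ ∧
    ∀ x ∈ S.X,
      (αlo ‖P x‖₊ : ℝ) ≤ W (P x) ∧ W (P x) ≤ (αhi ‖P x‖₊ : ℝ) ∧
      ∀ δ ∈ S.deltaRange P x, ρ ‖δ‖₊ ≤ ‖P x‖₊ →
        (⨅ u ∈ S.U, (S.Wdot P W x u δ : EReal)) ≤ ((-(α ‖P x‖₊ : ℝ) : ℝ) : EReal)

/-- The state feedback `κ` renders `W` decreasing in the sense of a PSS-CLF (with some class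
`K∞` functions `α`, `ρ`) at the nonzero states. -/
def IsDecreasingFeedback (P : Eucl n → Eucl k) (W : Eucl k → ℝ) (κ : Eucl n → Eucl m) : Prop :=
  ∃ α ρ : ℝ≥0 → ℝ≥0, IsClassKInfty α ∧ IsClassKInfty ρ ∧
    ∀ x ∈ S.X, x ≠ 0 → ∀ d ∈ S.D, ρ ‖S.delta P x (κ x) d‖₊ ≤ ‖P x‖₊ →
      S.Wdot P W x (κ x) (S.delta P x (κ x) d) ≤ -(α ‖P x‖₊ : ℝ)

/-- The time interval `[0, T)`, with `T ≤ ∞`. -/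
def timeInterval (T : EReal) : Set ℝ := {t | 0 ≤ t ∧ (t : EReal) < T}

/-- `x` is a (Carathéodory) solution on `[0, T)` of `x' = f(x, κ(x), d(t))`. A disturbance that
depends on the state or the input enters through its values `d(t)` along the solution. -/
structure IsSolution (κ : Eucl n → Eucl m) (T : EReal) (d : ℝ → Eucl l) (x : ℝ → Eucl n) :
    Prop where
  d_mem : ∀ t ∈ timeInterval T, d t ∈ S.D
  x_mem : ∀ t ∈ timeInterval T, x t ∈ S.X
  absolutelyContinuous : ∀ t ∈ timeInterval T, AbsolutelyContinuousOnInterval x 0 t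
  hasDerivAt : ∀ᵐ t ∂(volume.restrict (timeInterval T)),
    HasDerivAt x (S.f (x t) (κ (x t)) (d t)) t

/-- The essential supremum over `[0, T)` of the norm of the projected disturbance along a
trajectory. -/
def deltaSup (P : Eucl n → Eucl k) (κ : Eucl n → Eucl m) (T : EReal) (d : ℝ → Eucl l)
    (x : ℝ → Eucl n) : ℝ≥0∞ :=
  eLpNormEssSup (fun t => S.delta P (x t) (κ (x t)) (d t)) (volume.restrict (timeInterval T))

/-- Under the state feedback `κ`, the system is Projection to State Stable with respect to `P`. -/
def IsPSS (P : Eucl n → Eucl k) (κ : Eucl n → Eucl m) : Prop :=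
  ∃ (β : ℝ≥0 → ℝ≥0 → ℝ≥0) (γ : ℝ≥0 → ℝ≥0), IsClassKLInfty β ∧ IsClassKInfty γ ∧
    ∀ (T : EReal) (d : ℝ → Eucl l) (x : ℝ → Eucl n), S.IsSolution κ T d x →
      S.deltaSup P κ T d x ≠ ∞ →
      ∀ t ∈ timeInterval T,
        ‖x t‖₊ ≤ β ‖x 0‖₊ t.toNNReal + γ (S.deltaSup P κ T d x).toNNReal

end DisturbedSystem

end ProjStab

end

/-! For fixed `x` the derivative of `W` along the projected dynamics is affine in the disturbance
`δ`, with a linear part that does not involve `u`. An input nearly optimal for a nearly worst `δ` is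
therefore good for every admissible `δ`, so infimum and quantifier over `δ` can be exchanged
(`exists_uniform_input`). Choosing such an input at each state gives `κ`, with no regularity needed.

For stability, let `V` be `W ∘ P` along a solution. It is absolutely continuous, and `V' ≤ -φ(V)`
holds almost everywhere above a level `c` fixed by the disturbance bound. Either `V t ≤ c`, which
gives the gain, or `V` has stayed at least `V t` on `[0, t]`, so that `V t + t φ(V t) ≤ V 0`.
Inverting `v ↦ v + t φ(v)` yields the `KL∞` bound without solving a differential equation. -/

namespace ProjStab

/-! ### Comparison functions as order automorphisms of the half-line. -/

section ComparisonFunctions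

theorem IsClassKInfty.of_orderIso (e : ℝ≥0 ≃o ℝ≥0) : IsClassKInfty e where
  continuous := e.continuous
  strictMono := e.strictMono
  map_zero := by simpa using e.map_bot
  unbounded := e.tendsto_atTop

theorem IsClassKInfty.surjective {α : ℝ≥0 → ℝ≥0} (hα : IsClassKInfty α) :
    Function.Surjective α := fun p =>
  mem_range_of_exists_le_of_exists_ge hα.continuous ⟨0, by simp [hα.map_zero]⟩
    (hα.unbounded.eventually (eventually_ge_atTop p)).exists

theorem IsClassKInfty.exists_orderIso {α : ℝ≥0 → ℝ≥0} (hα : IsClassKInfty α) :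
    ∃ e : ℝ≥0 ≃o ℝ≥0, ⇑e = α :=
  ⟨hα.strictMono.orderIsoOfSurjective α hα.surjective, rfl⟩

theorem IsClassKInfty.half {α : ℝ≥0 → ℝ≥0} (hα : IsClassKInfty α) :
    IsClassKInfty fun r => α r / 2 := by
  obtain ⟨e, rfl⟩ := hα.exists_orderIso
  exact .of_orderIso (e.trans (OrderIso.divRight₀ (2 : ℝ≥0) two_pos))

/-- Adding a nonnegative multiple of a class `K∞` function to the identity gives a class `K∞`
function. -/
theorem isClassKInfty_add_mul (φ : ℝ≥0 ≃o ℝ≥0) (t : ℝ≥0) :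
    IsClassKInfty fun v => v + t * φ v where
  continuous := continuous_id.add (continuous_const.mul φ.continuous)
  strictMono := fun _ _ h => add_lt_add_of_lt_of_le h
    (mul_le_mul_of_nonneg_left (φ.monotone h.le) zero_le)
  map_zero := by simp [(IsClassKInfty.of_orderIso φ).map_zero]
  unbounded := tendsto_atTop_mono (fun _ => le_self_add) tendsto_id

/-- `v ↦ v + t φ(v)`; its inverse bounds a decaying function `V` with `V' ≤ -φ(V)`. -/
noncomputable def decayIso (φ : ℝ≥0 ≃o ℝ≥0) (t : ℝ≥0) : ℝ≥0 ≃o ℝ≥0 :=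
  (isClassKInfty_add_mul φ t).strictMono.orderIsoOfSurjective _
    (isClassKInfty_add_mul φ t).surjective

theorem decayIso_apply (φ : ℝ≥0 ≃o ℝ≥0) (t v : ℝ≥0) : decayIso φ t v = v + t * φ v := rfl

/-- For fixed `v`, comparing the inverse at `(r, t)` with `v` amounts to comparing `r` with `v + t
φ(v)`, and the strict comparisons are open conditions on `(r, t)`. -/
theorem continuous_decayIso_symm (φ : ℝ≥0 ≃o ℝ≥0) :
    Continuous fun p : ℝ≥0 × ℝ≥0 => (decayIso φ p.2).symm p.1 := by
  refine continuous_iff_continuousAt.2 fun p => tendsto_order.2 ⟨fun v hv => ?_, fun v hv => ?_⟩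
  · have h : v + p.2 * φ v < p.1 := (decayIso φ p.2).lt_symm_apply.1 hv
    have hc : Continuous fun q : ℝ≥0 × ℝ≥0 => v + q.2 * φ v := by fun_prop
    filter_upwards [hc.continuousAt.eventually_lt continuous_fst.continuousAt h] with q hq
    exact (decayIso φ q.2).lt_symm_apply.2 hq
  · have h : p.1 < v + p.2 * φ v := (decayIso φ p.2).symm_apply_lt.1 hv
    have hc : Continuous fun q : ℝ≥0 × ℝ≥0 => v + q.2 * φ v := by fun_prop
    filter_upwards [continuous_fst.continuousAt.eventually_lt hc.continuousAt h] with q hq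
    exact (decayIso φ q.2).symm_apply_lt.2 hq

theorem isClassKLInfty_decayIso_symm (φ : ℝ≥0 ≃o ℝ≥0) :
    IsClassKLInfty fun r t => (decayIso φ t).symm r where
  continuous := continuous_decayIso_symm φ
  classKInfty := fun t => .of_orderIso (decayIso φ t).symm
  antitone := fun r s t hst => by
    refine (decayIso φ t).symm_apply_le.2 ?_
    calc r = decayIso φ s ((decayIso φ s).symm r) := by simp
      _ ≤ decayIso φ t ((decayIso φ s).symm r) := by
        simp only [decayIso_apply]
        gcongr
  tendsto_zero := fun r => by
    refine tendsto_order.2 ⟨fun v hv => absurd hv not_lt_zero, fun v hv => ?_⟩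
    have hφ : 0 < φ v := by
      simpa [(IsClassKInfty.of_orderIso φ).map_zero] using φ.strictMono hv
    -- From this time on `t φ(v) > r`, so the inverse at `r` lies below `v`.
    filter_upwards [eventually_gt_atTop (r / φ v)] with t ht
    refine (decayIso φ t).symm_apply_lt.2 ?_
    rw [div_lt_iff₀ hφ] at ht
    exact ht.trans_le (by rw [decayIso_apply]; exact le_add_self)

/-- Class `KL∞` is stable under composition with class `K∞` functions inside and outside. -/
theorem IsClassKLInfty.comp {β : ℝ≥0 → ℝ≥0 → ℝ≥0} (hβ : IsClassKLInfty β) (e₁ e₂ : ℝ≥0 ≃o ℝ≥0) :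
    IsClassKLInfty fun r t => e₁ (β (e₂ r) t) where
  continuous := e₁.continuous.comp
    (hβ.continuous.comp ((e₂.continuous.comp continuous_fst).prodMk continuous_snd))
  classKInfty := fun t => by
    obtain ⟨e, he⟩ := (hβ.classKInfty t).exists_orderIso
    have : (fun r => e₁ (β (e₂ r) t)) = (e₂.trans e).trans e₁ := by
      funext r
      simp [congrFun he (e₂ r)]
    rw [this]
    exact .of_orderIso _
  antitone := fun r _ _ h => e₁.monotone (hβ.antitone (e₂ r) h)
  tendsto_zero := fun r => by
    have h := (e₁.continuous.tendsto 0).comp (hβ.tendsto_zero (e₂ r))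
    rwa [(IsClassKInfty.of_orderIso e₁).map_zero] at h

end ComparisonFunctions

/-! ### Absolutely continuous functions and a comparison principle. -/

section AbsolutelyContinuous

theorem absolutelyContinuousOnInterval_comp {X Y : Type*} [PseudoMetricSpace X]
    [PseudoMetricSpace Y] {x : ℝ → X} {a b : ℝ} (hx : AbsolutelyContinuousOnInterval x a b)
    {g : X → Y} {K : ℝ≥0} (hg : LipschitzOnWith K g (x '' uIcc a b)) :
    AbsolutelyContinuousOnInterval (fun t => g (x t)) a b := by
  rw [absolutelyContinuousOnInterval_iff] at hx ⊢
  intro ε hε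
  -- `K + 1` keeps the divisor positive when `K = 0`.
  obtain ⟨δ, hδ, h⟩ := hx (ε / (K + 1)) (by positivity)
  refine ⟨δ, hδ, fun E hE hlen => ?_⟩
  have h1 := h E hE hlen
  have hK : (0 : ℝ) < K + 1 := by positivity
  calc ∑ i ∈ Finset.range E.1, dist (g (x (E.2 i).1)) (g (x (E.2 i).2))
      ≤ ∑ i ∈ Finset.range E.1, (K + 1) * dist (x (E.2 i).1) (x (E.2 i).2) := by
        refine Finset.sum_le_sum fun i hi => ?_
        refine (hg.dist_le_mul _ (mem_image_of_mem x (hE.1 i hi).1) _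
          (mem_image_of_mem x (hE.1 i hi).2)).trans ?_
        gcongr
        linarith
    _ = (K + 1) * ∑ i ∈ Finset.range E.1, dist (x (E.2 i).1) (x (E.2 i).2) := by
        rw [Finset.mul_sum]
    _ < (K + 1) * (ε / (K + 1)) := by gcongr
    _ = ε := by field_simp

/-- A `C¹` map is locally Lipschitz, hence Lipschitz on the compact image of the curve. -/
theorem absolutelyContinuousOnInterval_comp_of_contDiffOn {E F : Type*} [NormedAddCommGroup E]
    [NormedSpace ℝ E] [NormedAddCommGroup F] [NormedSpace ℝ F] {x : ℝ → E} {a b : ℝ}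
    (hx : AbsolutelyContinuousOnInterval x a b) {g : E → F} {O : Set E} (hO : IsOpen O)
    (hxO : MapsTo x (uIcc a b) O) (hg : ContDiffOn ℝ 1 g O) :
    AbsolutelyContinuousOnInterval (fun t => g (x t)) a b := by
  have hL : LocallyLipschitzOn (x '' uIcc a b) g := by
    rintro _ ⟨t, ht, rfl⟩
    obtain ⟨K, s, hs, h⟩ :=
      ((hg.contDiffAt (hO.mem_nhds (hxO ht))).hasStrictFDerivAt one_ne_zero).exists_lipschitzOnWith
    exact ⟨K, s, mem_nhdsWithin_of_mem_nhds hs, h⟩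
  obtain ⟨K, hK⟩ :=
    hL.exists_lipschitzOnWith_of_compact (isCompact_uIcc.image_of_continuousOn hx.continuousOn)
  exact absolutelyContinuousOnInterval_comp hx hK

theorem AbsolutelyContinuousOnInterval.sub_le_of_deriv_le {V : ℝ → ℝ} {a b C : ℝ} (hab : a ≤ b)
    (hV : AbsolutelyContinuousOnInterval V a b)
    (h : ∀ᵐ τ ∂volume.restrict (Ioc a b), deriv V τ ≤ C) : V b - V a ≤ (b - a) * C := by
  rw [← hV.integral_deriv_eq_sub, ← smul_eq_mul, ← intervalIntegral.integral_const]
  simp only [intervalIntegral.integral_of_le hab]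
  exact setIntegral_mono_ae_restrict hV.intervalIntegrable_deriv.1
    intervalIntegrable_const.1 h

/-- A comparison principle: if `V' ≤ -φ(V)` almost everywhere where `V > c`, and `V` ends above
`c`, then `V` has decayed throughout, at least at the rate given by its final value. -/
theorem AbsolutelyContinuousOnInterval.add_mul_le {V φ : ℝ → ℝ} {t c : ℝ} (ht : 0 ≤ t)
    (hV : AbsolutelyContinuousOnInterval V 0 t) (hφ : MonotoneOn φ (Ioi c))
    (hφ0 : ∀ v ∈ Ioi c, 0 ≤ φ v)
    (hd : ∀ᵐ τ ∂volume.restrict (Ioc 0 t), c < V τ → deriv V τ ≤ -φ (V τ)) (hc : c < V t) :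
    V t + t * φ (V t) ≤ V 0 := by
  have hcont : ContinuousOn V (Icc 0 t) := by simpa [uIcc_of_le ht] using hV.continuousOn
  have hge : ∀ τ ∈ Icc 0 t, V t ≤ V τ := by
    by_contra! hlt
    obtain ⟨τ₀, hτ₀, hlt⟩ := hlt
    -- After the last time `τ₁` with `V ≤ w`, `V` exceeds `c` and so cannot increase; this
    -- contradicts `V τ₁ ≤ w < V t`.
    set w := max (V τ₀) c
    have hcont' : ContinuousOn V (Icc τ₀ t) := hcont.mono (Icc_subset_Icc_left hτ₀.1)
    have hcomp : IsCompact (Icc τ₀ t ∩ V ⁻¹' Iic w) :=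
      isCompact_Icc.of_isClosed_subset (hcont'.preimage_isClosed_of_isClosed isClosed_Icc
        isClosed_Iic) inter_subset_left
    obtain ⟨τ₁, ⟨hτ₁, hVτ₁⟩, hmax⟩ :=
      hcomp.exists_isGreatest ⟨τ₀, ⟨le_rfl, hτ₀.2⟩, le_max_left (V τ₀) c⟩
    have hτ₁0 : 0 ≤ τ₁ := hτ₀.1.trans hτ₁.1
    have hV' : AbsolutelyContinuousOnInterval V τ₁ t :=
      hV.mono (by rw [uIcc_of_le ht, uIcc_of_le hτ₁.2]; exact Icc_subset_Icc_left hτ₁0)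
    have hle := AbsolutelyContinuousOnInterval.sub_le_of_deriv_le (C := 0) hτ₁.2 hV' (by
      filter_upwards [ae_restrict_of_ae_restrict_of_subset (Ioc_subset_Ioc_left hτ₁0) hd,
        ae_restrict_mem measurableSet_Ioc] with τ h hτ
      have hwV : w < V τ := by
        by_contra! hle
        exact absurd (hmax ⟨⟨hτ₁.1.trans hτ.1.le, hτ.2⟩, hle⟩) (not_le.2 hτ.1)
      have hcV : c < V τ := (le_max_right _ _).trans_lt hwV
      linarith [h hcV, hφ0 _ hcV])
    have : V τ₁ < V t := lt_of_le_of_lt hVτ₁ (max_lt hlt hc)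
    linarith
  have hle := AbsolutelyContinuousOnInterval.sub_le_of_deriv_le (C := -φ (V t)) ht hV (by
    filter_upwards [hd, ae_restrict_mem measurableSet_Ioc] with τ h hτ
    have h1 := hge τ (Ioc_subset_Icc_self hτ)
    have h2 : c < V τ := hc.trans_le h1
    linarith [h h2, hφ hc h2 h1])
  linarith

end AbsolutelyContinuous

/-! ### The feedback, and the Lyapunov estimate along solutions. -/

namespace DisturbedSystem

variable {n m l k : ℕ} (S : DisturbedSystem n m l)

theorem projField_delta (P : Eucl n → Eucl k) (x : Eucl n) (u : Eucl m) (d : Eucl l) :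
    S.projField P x u (S.delta P x u d) = fderiv ℝ P x (S.f x u d) := by
  simp [projField, delta]

theorem Wdot_eq_add (P : Eucl n → Eucl k) (W : Eucl k → ℝ) (x : Eucl n) (u : Eucl m)
    (δ : Eucl k) :
    S.Wdot P W x u δ = S.Wdot P W x u 0 + fderiv ℝ W (P x) δ := by
  simp [Wdot, projField]

/-- At each state one input makes `W` decrease for all admissible projected disturbances: it is
almost optimal for an almost worst disturbance. -/
theorem exists_uniform_input {P : Eucl n → Eucl k} {W : Eucl k → ℝ} {α ρ : ℝ≥0 → ℝ≥0}
    (hρ : IsClassKInfty ρ) {x : Eucl n} (hα : 0 < α ‖P x‖₊)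
    (h : ∀ δ ∈ S.deltaRange P x, ρ ‖δ‖₊ ≤ ‖P x‖₊ →
      (⨅ u ∈ S.U, (S.Wdot P W x u δ : EReal)) ≤ ((-(α ‖P x‖₊ : ℝ) : ℝ) : EReal)) :
    ∃ u ∈ S.U, ∀ δ ∈ S.deltaRange P x, ρ ‖δ‖₊ ≤ ‖P x‖₊ →
      S.Wdot P W x u δ ≤ -((α ‖P x‖₊ / 2 : ℝ≥0) : ℝ) := by
  obtain ⟨r, rfl⟩ := hρ.exists_orderIso
  set a : ℝ := (α ‖P x‖₊ : ℝ)
  have ha0 : 0 < a := NNReal.coe_pos.2 hα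
  set L := fderiv ℝ W (P x)
  set A : Set (Eucl k) := {δ ∈ S.deltaRange P x | r ‖δ‖₊ ≤ ‖P x‖₊}
  have hbdd : BddAbove (L '' A) := by
    refine ⟨‖L‖ * (r.symm ‖P x‖₊ : ℝ), ?_⟩
    rintro _ ⟨δ, hδ, rfl⟩
    have h1 : ‖δ‖₊ ≤ r.symm ‖P x‖₊ := r.le_symm_apply.2 hδ.2
    have h2 : ‖δ‖ ≤ (r.symm ‖P x‖₊ : ℝ) := by exact_mod_cast h1
    calc L δ ≤ ‖L δ‖ := le_abs_self _
      _ ≤ ‖L‖ * ‖δ‖ := L.le_opNorm δ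
      _ ≤ _ := by gcongr
  have hne : (L '' A).Nonempty := by
    obtain ⟨u, hu⟩ := S.nonempty_U
    exact ⟨L 0, 0, ⟨⟨u, hu, 0, S.zero_mem_D, by simp [delta]⟩, by simp [hρ.map_zero]⟩, rfl⟩
  -- A quarter of `a` is lost in the choice of `δ₀` and another in that of `u`, which leaves the
  -- decrease `a / 2`.
  obtain ⟨_, ⟨δ₀, hδ₀, rfl⟩, hδ₀L⟩ :=
    exists_lt_of_lt_csSup hne (show sSup (L '' A) - a / 4 < sSup (L '' A) by linarith)
  have hlt : (⨅ u ∈ S.U, (S.Wdot P W x u δ₀ : EReal)) < ((-(3 * a / 4) : ℝ) : EReal) :=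
    (h δ₀ hδ₀.1 hδ₀.2).trans_lt (EReal.coe_lt_coe_iff.2 (by linarith))
  simp only [iInf_lt_iff] at hlt
  obtain ⟨u, hu, hlt⟩ := hlt
  have hlt' := EReal.coe_lt_coe_iff.1 hlt
  refine ⟨u, hu, fun δ hδ hδρ => ?_⟩
  have hle : L δ ≤ sSup (L '' A) := le_csSup hbdd ⟨δ, ⟨hδ, hδρ⟩, rfl⟩
  rw [Wdot_eq_add] at hlt' ⊢
  push_cast
  linarith

theorem norm_pos_of_isDynamicProjection {X : Set (Eucl n)} {P : Eucl n → Eucl k}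
    (hP : IsDynamicProjection X P) {x : Eucl n} (hx : x ∈ X) (h0 : x ≠ 0) : 0 < ‖P x‖₊ := by
  obtain ⟨-, σlo, σhi, hlo, -, h⟩ := hP
  refine lt_of_lt_of_le ?_ (h x hx).1
  rw [← hlo.map_zero]
  exact hlo.strictMono (nnnorm_pos.2 h0)

theorem exists_isDecreasingFeedback {P : Eucl n → Eucl k} (hP : IsDynamicProjection S.X P)
    {W : Eucl k → ℝ} (hW : S.IsPSSCLF P W) :
    ∃ κ : Eucl n → Eucl m, MapsTo κ S.X S.U ∧ S.IsDecreasingFeedback P W κ := by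
  obtain ⟨-, _, _, α, ρ, -, -, hα, hρ, hW⟩ := hW
  have key : ∀ x : Eucl n, ∃ u ∈ S.U, x ∈ S.X → x ≠ 0 → ∀ δ ∈ S.deltaRange P x,
      ρ ‖δ‖₊ ≤ ‖P x‖₊ → S.Wdot P W x u δ ≤ -((α ‖P x‖₊ / 2 : ℝ≥0) : ℝ) := by
    intro x
    by_cases hx : x ∈ S.X ∧ x ≠ 0
    · have hpos : 0 < α ‖P x‖₊ := by
        rw [← hα.map_zero]
        exact hα.strictMono (norm_pos_of_isDynamicProjection hP hx.1 hx.2)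
      obtain ⟨u, hu, h⟩ := S.exists_uniform_input hρ hpos (hW x hx.1).2.2
      exact ⟨u, hu, fun _ _ => h⟩
    -- At the origin `α ‖P x‖₊ = 0` leaves no slack for an almost optimal input; any input will do
    -- there.
    · obtain ⟨u, hu⟩ := S.nonempty_U
      exact ⟨u, hu, fun h1 h2 => absurd ⟨h1, h2⟩ hx⟩
  choose κ hκU hκ using key
  exact ⟨κ, fun x _ => hκU x, fun r => α r / 2, ρ, hα.half, hρ,
    fun x hx h0 d hd hle => hκ x hx h0 _ ⟨κ x, hκU x, d, hd, rfl⟩ hle⟩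

theorem Icc_subset_timeInterval {T : EReal} {t : ℝ} (ht : t ∈ timeInterval T) :
    Icc 0 t ⊆ timeInterval T := fun _ hτ =>
  ⟨hτ.1, (EReal.coe_le_coe_iff.2 hτ.2).trans_lt ht.2⟩

variable {S} {P : Eucl n → Eucl k} {W : Eucl k → ℝ} {κ : Eucl n → Eucl m} {T : EReal}
  {d : ℝ → Eucl l} {x : ℝ → Eucl n}

theorem IsSolution.absolutelyContinuous_lyapunov (hx : S.IsSolution κ T d x) (hP : IsC1On P S.X)
    (hW : IsC1On W (P '' S.X)) {t : ℝ} (ht : t ∈ timeInterval T) :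
    AbsolutelyContinuousOnInterval (fun τ => W (P (x τ))) 0 t := by
  obtain ⟨O, hO, hXO, hPO⟩ := hP
  obtain ⟨O', hO', hXO', hWO'⟩ := hW
  have hmem : ∀ τ ∈ uIcc 0 t, x τ ∈ S.X := fun τ hτ =>
    hx.x_mem τ (Icc_subset_timeInterval ht (by rwa [uIcc_of_le ht.1] at hτ))
  have hPx := absolutelyContinuousOnInterval_comp_of_contDiffOn (hx.absolutelyContinuous t ht) hO
    (fun τ hτ => hXO (hmem τ hτ)) hPO
  exact absolutelyContinuousOnInterval_comp_of_contDiffOn hPx hO'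
    (fun τ hτ => hXO' (mem_image_of_mem P (hmem τ hτ))) hWO'

theorem IsSolution.ae_deriv_lyapunov (hx : S.IsSolution κ T d x) (hP : IsC1On P S.X)
    (hW : IsC1On W (P '' S.X)) {t : ℝ} (ht : t ∈ timeInterval T) :
    ∀ᵐ τ ∂volume.restrict (Ioc 0 t), deriv (fun τ => W (P (x τ))) τ =
      S.Wdot P W (x τ) (κ (x τ)) (S.delta P (x τ) (κ (x τ)) (d τ)) := by
  obtain ⟨O, hO, hXO, hPO⟩ := hP
  obtain ⟨O', hO', hXO', hWO'⟩ := hW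
  have hsub : Ioc 0 t ⊆ timeInterval T := Ioc_subset_Icc_self.trans (Icc_subset_timeInterval ht)
  filter_upwards [ae_restrict_of_ae_restrict_of_subset hsub hx.hasDerivAt,
    ae_restrict_mem measurableSet_Ioc] with τ hτ hτt
  have hX := hx.x_mem τ (hsub hτt)
  have hPd : HasFDerivAt P (fderiv ℝ P (x τ)) (x τ) :=
    ((hPO.contDiffAt (hO.mem_nhds (hXO hX))).differentiableAt one_ne_zero).hasFDerivAt
  have hWd : HasFDerivAt W (fderiv ℝ W (P (x τ))) (P (x τ)) :=
    ((hWO'.contDiffAt (hO'.mem_nhds (hXO' (mem_image_of_mem P hX)))).differentiableAt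
      one_ne_zero).hasFDerivAt
  rw [Wdot, projField_delta]
  exact (hWd.comp_hasDerivAt τ (hPd.comp_hasDerivAt τ hτ)).deriv

theorem IsSolution.ae_delta_le (hδ : S.deltaSup P κ T d x ≠ ∞) {t : ℝ} (ht : t ∈ timeInterval T) :
    ∀ᵐ τ ∂volume.restrict (Ioc 0 t),
      ‖S.delta P (x τ) (κ (x τ)) (d τ)‖₊ ≤ (S.deltaSup P κ T d x).toNNReal := by
  have hsub : Ioc 0 t ⊆ timeInterval T := Ioc_subset_Icc_self.trans (Icc_subset_timeInterval ht)
  have h := enorm_ae_le_eLpNormEssSup (fun t => S.delta P (x t) (κ (x t)) (d t))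
    (volume.restrict (timeInterval T))
  filter_upwards [ae_restrict_of_ae_restrict_of_subset hsub h] with τ hτ
  rw [← ENNReal.coe_le_coe, ENNReal.coe_toNNReal hδ]
  exact hτ

theorem IsDecreasingFeedback.isPSS (hP : IsDynamicProjection S.X P) (hW : S.IsPSSCLF P W)
    (hκ : S.IsDecreasingFeedback P W κ) : S.IsPSS P κ := by
  obtain ⟨hW1, αlo, αhi, _, _, hαlo, hαhi, -, -, hWb⟩ := hW
  obtain ⟨hP1, σlo, σhi, hσlo, hσhi, hPb⟩ := hP
  obtain ⟨α, ρ, hα, hρ, hdec⟩ := hκ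
  obtain ⟨elo, rfl⟩ := hαlo.exists_orderIso
  obtain ⟨ehi, rfl⟩ := hαhi.exists_orderIso
  obtain ⟨slo, rfl⟩ := hσlo.exists_orderIso
  obtain ⟨shi, rfl⟩ := hσhi.exists_orderIso
  obtain ⟨a, rfl⟩ := hα.exists_orderIso
  obtain ⟨r, rfl⟩ := hρ.exists_orderIso
  -- `V ≤ ehi ‖P x‖` turns the decay rate `a ‖P x‖` into `φ(V)`, while `θ ‖x‖ ≤ V` recovers the
  -- state.
  set φ : ℝ≥0 ≃o ℝ≥0 := ehi.symm.trans a
  set θ : ℝ≥0 ≃o ℝ≥0 := slo.trans elo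
  refine ⟨fun q t => θ.symm ((decayIso φ t).symm ((shi.trans ehi) q)), (r.trans ehi).trans θ.symm,
    (isClassKLInfty_decayIso_symm φ).comp θ.symm (shi.trans ehi), .of_orderIso _, ?_⟩
  intro T d x hx hδ t ht
  set s := (S.deltaSup P κ T d x).toNNReal
  have h0 : (0 : ℝ) ∈ timeInterval T := Icc_subset_timeInterval ht ⟨le_rfl, ht.1⟩
  set v : ℝ≥0 := (W (P (x t))).toNNReal
  have hWnn : ∀ {y}, y ∈ S.X → 0 ≤ W (P y) := fun hy => (NNReal.coe_nonneg _).trans (hWb _ hy).1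
  have hvW : (v : ℝ) = W (P (x t)) := Real.coe_toNNReal _ (hWnn (hx.x_mem t ht))
  have hθv : ‖x t‖₊ ≤ θ.symm v := by
    refine θ.le_symm_apply.2 ?_
    have h1 : elo ‖P (x t)‖₊ ≤ v := by
      rw [← NNReal.coe_le_coe, hvW]
      exact (hWb _ (hx.x_mem t ht)).1
    exact (elo.monotone (hPb _ (hx.x_mem t ht)).1).trans h1
  -- Above this level `‖P x‖ > r s`, so the disturbance is small enough for the decrease condition
  -- to apply.
  by_cases hc : v ≤ ehi (r s)
  · exact (hθv.trans (θ.symm.monotone hc)).trans le_add_self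
  · push Not at hc
    refine (hθv.trans (θ.symm.monotone ?_)).trans le_self_add
    refine (decayIso φ t.toNNReal).le_symm_apply.2 ?_
    have hmain := AbsolutelyContinuousOnInterval.add_mul_le
      (V := fun τ => W (P (x τ))) (φ := fun w => (φ w.toNNReal : ℝ)) (c := (ehi (r s) : ℝ)) ht.1
      (hx.absolutelyContinuous_lyapunov hP1 hW1 ht)
      (fun _ _ _ _ h => NNReal.coe_le_coe.2 (φ.monotone (Real.toNNReal_mono h)))
      (fun _ _ => NNReal.coe_nonneg _) (by
        filter_upwards [hx.ae_deriv_lyapunov hP1 hW1 ht, IsSolution.ae_delta_le hδ ht,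
          ae_restrict_mem measurableSet_Ioc] with τ hτ hτδ hτt hcτ
        have hτT := Icc_subset_timeInterval ht (Ioc_subset_Icc_self hτt)
        have hX := hx.x_mem τ hτT
        have hhi := (hWb _ hX).2.1
        have hrs : r s < ‖P (x τ)‖₊ :=
          ehi.lt_iff_lt.1 (NNReal.coe_lt_coe.1 (hcτ.trans_le hhi))
        have hx0 : x τ ≠ 0 := by
          intro h
          have h2 := (hPb _ hX).2
          rw [h, nnnorm_zero, hσhi.map_zero, ← h] at h2
          exact absurd (hrs.trans_le h2) not_lt_zero
        rw [hτ]
        refine (hdec _ hX hx0 _ (hx.d_mem τ hτT) ((r.monotone hτδ).trans hrs.le)).trans ?_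
        refine neg_le_neg (NNReal.coe_le_coe.2 (a.monotone (ehi.symm_apply_le.2 ?_)))
        exact Real.toNNReal_le_iff_le_coe.2 hhi)
      (by
        rw [← hvW]
        exact NNReal.coe_lt_coe.2 hc)
    have hx0 : W (P (x 0)) ≤ (ehi (shi ‖x 0‖₊) : ℝ) :=
      (hWb _ (hx.x_mem 0 h0)).2.1.trans
        (NNReal.coe_le_coe.2 (ehi.monotone (hPb _ (hx.x_mem 0 h0)).2))
    rw [decayIso_apply, ← NNReal.coe_le_coe]
    push_cast
    rw [hvW, Real.coe_toNNReal _ ht.1]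
    exact hmain.trans hx0

end DisturbedSystem

end ProjStab

theorem theorem1 {n m l k : ℕ} (S : ProjStab.DisturbedSystem n m l)
    (P : ProjStab.Eucl n → ProjStab.Eucl k) (hP : ProjStab.IsDynamicProjection S.X P)
    (W : ProjStab.Eucl k → ℝ) (hW : S.IsPSSCLF P W) :
    (∃ κ : ProjStab.Eucl n → ProjStab.Eucl m, Set.MapsTo κ S.X S.U ∧
      S.IsDecreasingFeedback P W κ ∧ S.IsPSS P κ) ∧
    (∀ κ : ProjStab.Eucl n → ProjStab.Eucl m, Set.MapsTo κ S.X S.U →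
      S.IsDecreasingFeedback P W κ → S.IsPSS P κ) := by
  obtain ⟨κ, hκU, hκ⟩ := S.exists_isDecreasingFeedback hP hW
  exact ⟨⟨κ, hκU, hκ, hκ.isPSS hP hW⟩, fun κ _ hκ => hκ.isPSS hP hW⟩
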